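/- Let $\psi>0$ and $\xi<1/4$, and let $\mathrm{GPD}(\xi,\psi)$ be the generalized Pareto distribution, i.e. the distribution supported on $\{x\ge 0:\ 1+\xi x/\psi\ge 0\}$ with distribution function $F(x)=1-(1+\xi x/\psi)^{-1/\xi}$ there (and $F(x)=1-e^{-x/\psi}$ if $\xi=0$). Let $X_1,X_2,\dots$ be i.i.d. with distribution $\mathrm{GPD}(\xi,\psi)$, and let $t\ge 0$ be a fixed threshold with $\psi+\xi t>0$ (that is, $F(t)<1$). For the sample $X_1,\dots,X_n$ let $n(t)=\sum_{j=1}^n 1_{(X_j>t)}$ be the number of exceedances, and let $$cv(t)=\frac{\mathrm{sd}\{X_j-t : j\le n,\ X_j>t\}}{\mathrm{mean}\{X_j-t : j\le n,\ X_j>t\}}$$ be the empirical coefficient of variation of the threshold excesses, where $\mathrm{sd}$ is the sample standard deviation with divisor either $n(t)$ or $n(t)-1$ (and $cv(t)=0$, say, when it is undefined). Put $c_\xi=\sqrt{1/(1-2\xi)}$. Then, as $n\to\infty$, $$\sqrt{n(t)}\,\bigl(cv(t)-c_\xi\bigr)\ \overset{d}{\longrightarrow}\ N(0,\sigma_\xi^2),\qquad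 \sigma_\xi^2=\frac{(1-\xi)^2(6\xi^2-\xi+1)}{(1-2\xi)^2(1-3\xi)(1-4\xi)}.$$ In particular $\sigma_0^2=1$ and $\sigma_{-1}^2=8/45$. -/

import Mathlib

open MeasureTheory ProbabilityTheory Filter

/-- Distribution function of the generalized Pareto distribution with shape `ξ` and scale `ψ > 0`:
it is `1 - (1 + ξ x / ψ) ^ (-1 / ξ)` on the range `x > 0`, `1 + ξ x / ψ > 0` (with the exponential
distribution as the limit case `ξ = 0`), `0` to the left of this range and `1` to the right. -/
noncomputable def gpdCDF (ξ ψ x : ℝ) : ℝ :=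
  if x ≤ 0 then 0
  else if ξ = 0 then 1 - Real.exp (-x / ψ)
  else if 1 + ξ * x / ψ ≤ 0 then 1
  else 1 - (1 + ξ * x / ψ) ^ (-1 / ξ)

/-- The measure `ν` on the real line is the law `GPD(ξ, ψ)`. -/
def IsGPD (ξ ψ : ℝ) (ν : Measure ℝ) : Prop :=
  IsProbabilityMeasure ν ∧ ∀ x : ℝ, cdf ν x = gpdCDF ξ ψ x

/-- The coefficient of variation `c_ξ` of a `GPD(ξ, ψ)`. -/
noncomputable def gpdCV (ξ : ℝ) : ℝ :=
  √(1 / (1 - 2 * ξ))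

/-- The asymptotic variance `σ_ξ²`. -/
noncomputable def gpdAsympVar (ξ : ℝ) : ℝ :=
  (1 - ξ) ^ 2 * (6 * ξ ^ 2 - ξ + 1) / ((1 - 2 * ξ) ^ 2 * (1 - 3 * ξ) * (1 - 4 * ξ))

/-- The indices of the exceedances of `t` in the sample `x 0, …, x (n - 1)`. -/
noncomputable def exceedances (x : ℕ → ℝ) (n : ℕ) (t : ℝ) : Finset ℕ :=
  (Finset.range n).filter (fun j => t < x j)

/-- The number `n(t)` of exceedances. -/
noncomputable def numExceedances (x : ℕ → ℝ) (n : ℕ) (t : ℝ) : ℕ :=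
  (exceedances x n t).card

/-- The sample mean of the threshold excesses `x j - t`, `x j > t`. -/
noncomputable def meanExcess (x : ℕ → ℝ) (n : ℕ) (t : ℝ) : ℝ :=
  (∑ j ∈ exceedances x n t, (x j - t)) / (numExceedances x n t : ℝ)

/-- The sample standard deviation of the threshold excesses, the sum of squares being divided by
`n(t) - d`: `d = 0` and `d = 1` are the two usual conventions. -/
noncomputable def sdExcess (d : ℕ) (x : ℕ → ℝ) (n : ℕ) (t : ℝ) : ℝ :=
  √((∑ j ∈ exceedances x n t, ((x j - t) - meanExcess x n t) ^ 2) /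
    ((numExceedances x n t : ℝ) - (d : ℝ)))

/-- The empirical residual coefficient of variation `cv(t)`. -/
noncomputable def residualCV (d : ℕ) (x : ℕ → ℝ) (n : ℕ) (t : ℝ) : ℝ :=
  sdExcess d x n t / meanExcess x n t

open scoped Topology

/-!
The empirical coefficient of variation of the excesses over `t` is a smooth function, homogeneous
of degree `0`, of the power sums `∑ (1, y, y²)` over the excesses `y`, and these are sums over the
whole sample of the i.i.d. vectors `1_{X > t} (1, X - t, (X - t)²)`. Chebyshev's inequality bounds
the fluctuations of their averages, so the delta method reduces `√n (cv(t) - c)` to the central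
limit theorem for the linearization, whose variance is `Var(φ) / P(X > t)` with `φ` the influence
function of the coefficient of variation at the law of the excesses. As `n(t) / n → P(X > t)`
almost surely, Slutsky's theorem replaces `√n` by `√n(t)`, and absorbs the divisor `n(t) - d`, so
that the limiting variance becomes `Var(φ)`.

The law of the excesses of `GPD(ξ, ψ)` over `t` is `GPD(ξ, ψ + ξ t)`. Its first four moments are
read off the representation of a GPD variable as an increasing function `q` of a standard
exponential one: since `q' = ψ + ξ q`, integration by parts gives a recursion for
`∫ q ^ k e⁻ᵘ du`.
-/

/-- The family `Z` of random vectors is bounded in probability, `Z i = O_P(1)`, under `P`. -/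
def BoundedInProbability {Ω ι E : Type*} [MeasurableSpace Ω] [Norm E] (P : Measure Ω)
    (Z : ι → Ω → E) : Prop :=
  ∀ η > 0, ∃ M > 0, ∀ i, P.real {ω | M ≤ ‖Z i ω‖} ≤ η

lemma tendstoInMeasure_smul_comp_of_isLittleO {Ω E F : Type*} [MeasurableSpace Ω] {P : Measure Ω}
    [IsFiniteMeasure P] [SeminormedAddCommGroup E] [NormedSpace ℝ E] [SeminormedAddCommGroup F]
    [NormedSpace ℝ F] {ι : Type*} {l : Filter ι} {a : ι → ℝ} {Z : ι → Ω → E} {θ : E} {r : E → F}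
    (ha : Tendsto a l atTop) (hr : r =o[𝓝 θ] fun z => z - θ)
    (hZ : BoundedInProbability P fun i ω => a i • (Z i ω - θ)) :
    TendstoInMeasure P (fun i ω => a i • r (Z i ω)) l 0 := by
  rw [tendstoInMeasure_iff_measureReal_norm]
  intro ε hε
  refine tendsto_order.2
    ⟨fun b hb => Eventually.of_forall fun i => hb.trans_le measureReal_nonneg, fun η hη => ?_⟩
  obtain ⟨M, hM, hbound⟩ := hZ (η / 2) (half_pos hη)
  obtain ⟨δ, hδ, hsmall⟩ :=
    Metric.eventually_nhds_iff.1 (hr.def (by positivity : 0 < ε / (2 * M)))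
  filter_upwards [ha.eventually_ge_atTop (M / δ), ha.eventually_gt_atTop 0] with i hi hi0
  refine (measureReal_mono fun ω hω => ?_).trans_lt ((hbound i).trans_lt (half_lt_self hη))
  simp only [Set.mem_ofPred_eq, Pi.zero_apply, sub_zero, norm_smul,
    Real.norm_of_nonneg hi0.le] at hω ⊢
  by_contra! hlt
  have hclose : dist (Z i ω) θ < δ := by
    rw [dist_eq_norm]
    exact lt_of_mul_lt_mul_left (hlt.trans_le ((div_le_iff₀ hδ).1 hi)) hi0.le
  refine hω.not_gt ?_
  calc a i * ‖r (Z i ω)‖ ≤ a i * (ε / (2 * M) * ‖Z i ω - θ‖) := by gcongr; exact hsmall hclose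
    _ = ε / (2 * M) * (a i * ‖Z i ω - θ‖) := by ring
    _ ≤ ε / (2 * M) * M := by gcongr
    _ < ε := by field_simp; linarith

section DeltaMethod
variable {Ω : Type*} [MeasurableSpace Ω] {P : Measure Ω}
variable {E : Type*} [NormedAddCommGroup E] [InnerProductSpace ℝ E] [CompleteSpace E]
  [MeasurableSpace E] [BorelSpace E]

lemma integral_inner_eq_zero_of_indepFun {X Y : Ω → E} (hXY : IndepFun X Y P) (hX : Integrable X P)
    (hY : Integrable Y P) (hX0 : P[X] = 0) : ∫ ω, inner ℝ (X ω) (Y ω) ∂P = 0 :=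
  (hXY.integral_bilin hX hY (innerSL ℝ)).trans (by simp [hX0])

lemma integral_norm_sq_sum [IsFiniteMeasure P] {ι : Type*} {V : ι → Ω → E} {s : Finset ι}
    (hV : ∀ i ∈ s, MemLp (V i) 2 P) (hzero : ∀ i ∈ s, P[V i] = 0)
    (hindep : (s : Set ι).Pairwise fun i j => IndepFun (V i) (V j) P) :
    ∫ ω, ‖∑ i ∈ s, V i ω‖ ^ 2 ∂P = ∑ i ∈ s, ∫ ω, ‖V i ω‖ ^ 2 ∂P := by
  have hint (i) (hi : i ∈ s) (j) (hj : j ∈ s) :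
      Integrable (fun ω => inner ℝ (V i ω) (V j ω)) P :=
    ((hV i hi).norm.integrable_mul (hV j hj).norm).mono' ((hV i hi).1.inner (hV j hj).1)
      (ae_of_all _ fun ω => norm_inner_le_norm _ _)
  have hi1 (i) (hi : i ∈ s) := (hV i hi).integrable one_le_two
  simp only [← real_inner_self_eq_norm_sq, inner_sum, sum_inner]
  rw [integral_finsetSum _ fun i hi => integrable_finsetSum _ fun j hj => hint j hj i hi]
  refine Finset.sum_congr rfl fun i hi => ?_
  rw [integral_finsetSum _ fun j hj => hint j hj i hi]
  refine Finset.sum_eq_single_of_mem i hi fun j hj hji => ?_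
  exact integral_inner_eq_zero_of_indepFun (hindep hj hi hji) (hi1 j hj) (hi1 i hi) (hzero j hj)

variable {V : ℕ → Ω → E} [IsProbabilityMeasure P]

lemma integral_norm_average_sub_sq (hV : MemLp (V 0) 2 P)
    (hindep : Pairwise fun i j => IndepFun (V i) (V j) P)
    (hident : ∀ i, IdentDistrib (V i) (V 0) P P) {n : ℕ} (hn : n ≠ 0) :
    ∫ ω, ‖(n : ℝ)⁻¹ • ∑ j ∈ Finset.range n, V j ω - P[V 0]‖ ^ 2 ∂P =
      (n : ℝ)⁻¹ * ∫ ω, ‖V 0 ω - P[V 0]‖ ^ 2 ∂P := by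
  set W : ℕ → Ω → E := fun j ω => V j ω - P[V 0]
  have hsub : Measurable fun v : E => v - P[V 0] := measurable_id.sub_const _
  have hWident (j) : IdentDistrib (W j) (W 0) P P := (hident j).comp hsub
  have hW (j) : MemLp (W j) 2 P := (hWident j).memLp_iff.2 (hV.sub (memLp_const _))
  have hW0 (j) : P[W j] = 0 := by
    rw [(hWident j).integral_eq, integral_sub (hV.integrable one_le_two) (integrable_const _)]
    simp
  have hWindep {i j : ℕ} (hij : i ≠ j) : IndepFun (W i) (W j) P := (hindep hij).comp hsub hsub
  have hmom (j) : ∫ ω, ‖W j ω‖ ^ 2 ∂P = ∫ ω, ‖W 0 ω‖ ^ 2 ∂P :=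
    ((hWident j).comp (by fun_prop : Measurable fun v : E => ‖v‖ ^ 2)).integral_eq
  have hcenter (ω) : (n : ℝ)⁻¹ • ∑ j ∈ Finset.range n, V j ω - P[V 0] =
      (n : ℝ)⁻¹ • ∑ j ∈ Finset.range n, W j ω := by
    simp only [W, Finset.sum_sub_distrib, Finset.sum_const, Finset.card_range, smul_sub,
      ← Nat.cast_smul_eq_nsmul ℝ, inv_smul_smul₀ (Nat.cast_ne_zero.2 hn : (n : ℝ) ≠ 0)]
  simp only [hcenter, norm_smul, mul_pow]
  rw [integral_const_mul, integral_norm_sq_sum (fun j _ => hW j) (fun j _ => hW0 j)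
    fun i _ j _ hij => hWindep hij]
  simp only [hmom, Finset.sum_const, Finset.card_range, nsmul_eq_mul, norm_inv, norm_natCast]
  field_simp
  rfl

lemma boundedInProbability_sqrt_smul_average_sub (hV : MemLp (V 0) 2 P)
    (hindep : Pairwise fun i j => IndepFun (V i) (V j) P)
    (hident : ∀ i, IdentDistrib (V i) (V 0) P P) :
    BoundedInProbability P fun (n : ℕ) ω =>
      √n • ((n : ℝ)⁻¹ • ∑ j ∈ Finset.range n, V j ω - P[V 0]) := by
  have hL (j) : MemLp (V j) 2 P := (hident j).memLp_iff.2 hV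
  set K := ∫ ω, ‖V 0 ω - P[V 0]‖ ^ 2 ∂P
  have hK : 0 ≤ K := integral_nonneg fun ω => by positivity
  have hsecond (n : ℕ) :
      ∫ ω, ‖√n • ((n : ℝ)⁻¹ • ∑ j ∈ Finset.range n, V j ω - P[V 0])‖ ^ 2 ∂P ≤ K := by
    rcases eq_or_ne n 0 with rfl | hn
    · simpa using hK
    simp only [norm_smul, mul_pow, Real.norm_eq_abs, sq_abs, Real.sq_sqrt n.cast_nonneg]
    rw [integral_const_mul, integral_norm_average_sub_sq hV hindep hident hn,
      mul_inv_cancel_left₀ (Nat.cast_ne_zero.2 hn)]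
  intro η hη
  refine ⟨√((K + 1) / η), by positivity, fun n => ?_⟩
  have hint : Integrable
      (fun ω => ‖√n • ((n : ℝ)⁻¹ • ∑ j ∈ Finset.range n, V j ω - P[V 0])‖ ^ 2) P :=
    ((((memLp_finsetSum _ fun j _ => hL j).const_smul _).sub (memLp_const _)).const_smul
      _).integrable_norm_pow two_ne_zero
  have hmarkov := (mul_meas_ge_le_integral_of_nonneg (ae_of_all _ fun ω => by positivity) hint
    ((K + 1) / η)).trans (hsecond n)
  simp only [Real.sqrt_le_left (norm_nonneg _)]
  rw [div_mul_eq_mul_div, div_le_iff₀ hη] at hmarkov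
  nlinarith

variable [SecondCountableTopology E] {Ω' : Type*} [MeasurableSpace Ω'] {P' : Measure Ω'}
  [IsProbabilityMeasure P']

theorem tendstoInDistribution_delta_method {g : E → ℝ} {L : E →L[ℝ] ℝ} {Y : Ω' → ℝ}
    (hV : MemLp (V 0) 2 P) (hindep : iIndepFun V P) (hident : ∀ i, IdentDistrib (V i) (V 0) P P)
    (hgm : Measurable g) (hg : HasFDerivAt g L (P[V 0]))
    (hY : HasLaw Y (gaussianReal 0 Var[fun ω => L (V 0 ω); P].toNNReal) P') :
    TendstoInDistribution
      (fun (n : ℕ) ω => √n * (g ((n : ℝ)⁻¹ • ∑ j ∈ Finset.range n, V j ω) - g (P[V 0])))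
      atTop Y (fun _ => P) P' := by
  have hclt := tendstoInDistribution_inv_sqrt_mul_sum_sub (X := fun j ω => L (V j ω)) hY
    (L.comp_memLp' hV) (hindep.comp (fun _ => L) fun _ => L.continuous.measurable)
    fun j => (hident j).comp L.continuous.measurable
  have hlin (n : ℕ) (ω) : √n * L ((n : ℝ)⁻¹ • ∑ j ∈ Finset.range n, V j ω - P[V 0]) =
      (√n)⁻¹ * (∑ j ∈ Finset.range n, L (V j ω) - n * ∫ ω, L (V 0 ω) ∂P) := by
    rcases eq_or_ne n 0 with rfl | hn
    · simp
    rw [L.integral_comp_comm (hV.integrable one_le_two), map_sub, map_smul, map_sum, smul_eq_mul]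
    field_simp
    rw [Real.sq_sqrt n.cast_nonneg]
  have hrem := tendstoInMeasure_smul_comp_of_isLittleO
    (Real.tendsto_sqrt_atTop.comp tendsto_natCast_atTop_atTop) hg.isLittleO
    (boundedInProbability_sqrt_smul_average_sub hV (fun _ _ hij => hindep.indepFun hij) hident)
  have havg (n : ℕ) : AEMeasurable (fun ω => (n : ℝ)⁻¹ • ∑ j ∈ Finset.range n, V j ω) P :=
    (Finset.aemeasurable_fun_sum _ fun j _ => (hident j).aemeasurable_fst).const_smul _
  refine tendstoInDistribution_of_tendstoInMeasure_sub _ _ hclt ?_ fun n =>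
    ((hgm.comp_aemeasurable (havg n)).sub_const _).const_mul _
  refine hrem.congr' (Eventually.of_forall fun n => Eventually.of_forall fun ω => ?_) .rfl
  simp only [Pi.sub_apply, Function.comp_apply, smul_eq_mul, ← hlin]
  ring

end DeltaMethod

/-- The coefficient of variation of a finite sample, or of a law, as a function of the vector
`(s₀, s₁, s₂)` of its power sums, or of its moments up to a common factor. -/
noncomputable def cvOfSums (s : EuclideanSpace ℝ (Fin 3)) : ℝ :=
  √(s 0 * s 2 - s 1 ^ 2) / s 1

lemma measurable_cvOfSums : Measurable cvOfSums := by
  unfold cvOfSums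
  fun_prop

lemma cvOfSums_smul {r : ℝ} (hr : 0 < r) (s : EuclideanSpace ℝ (Fin 3)) :
    cvOfSums (r • s) = cvOfSums s := by
  have h : r * s 0 * (r * s 2) - (r * s 1) ^ 2 = r ^ 2 * (s 0 * s 2 - s 1 ^ 2) := by ring
  simp only [cvOfSums, PiLp.smul_apply, smul_eq_mul]
  rw [h, Real.sqrt_mul (by positivity), Real.sqrt_sq hr.le, mul_div_mul_left _ _ hr.ne']

/-- The derivative of `cvOfSums` at `s`. -/
noncomputable def cvOfSumsDeriv (s : EuclideanSpace ℝ (Fin 3)) : EuclideanSpace ℝ (Fin 3) →L[ℝ] ℝ :=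
  (2 * √(s 0 * s 2 - s 1 ^ 2) * s 1 ^ 2)⁻¹ • ((s 1 * s 2) • EuclideanSpace.proj 0 -
    (2 * (s 0 * s 2)) • EuclideanSpace.proj 1 + (s 0 * s 1) • EuclideanSpace.proj 2)

lemma cvOfSumsDeriv_apply (s v : EuclideanSpace ℝ (Fin 3)) :
    cvOfSumsDeriv s v = (2 * √(s 0 * s 2 - s 1 ^ 2) * s 1 ^ 2)⁻¹ *
      (s 1 * s 2 * v 0 - 2 * (s 0 * s 2) * v 1 + s 0 * s 1 * v 2) :=
  rfl

lemma cvOfSumsDeriv_smul {r : ℝ} (hr : 0 < r) (s : EuclideanSpace ℝ (Fin 3)) :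
    cvOfSumsDeriv (r • s) = r⁻¹ • cvOfSumsDeriv s := by
  have h : r * s 0 * (r * s 2) - (r * s 1) ^ 2 = r ^ 2 * (s 0 * s 2 - s 1 ^ 2) := by ring
  ext v
  simp only [cvOfSumsDeriv_apply, smul_apply, PiLp.smul_apply, smul_eq_mul]
  rw [h, Real.sqrt_mul (by positivity), Real.sqrt_sq hr.le]
  field_simp

lemma cvOfSumsDeriv_self (s : EuclideanSpace ℝ (Fin 3)) : cvOfSumsDeriv s s = 0 := by
  rw [cvOfSumsDeriv_apply]
  ring

lemma hasFDerivAt_cvOfSums {s : EuclideanSpace ℝ (Fin 3)} (h1 : s 1 ≠ 0)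
    (h2 : 0 < s 0 * s 2 - s 1 ^ 2) : HasFDerivAt cvOfSums (cvOfSumsDeriv s) s := by
  have hproj (i : Fin 3) : HasFDerivAt (fun s : EuclideanSpace ℝ (Fin 3) => s i)
      (EuclideanSpace.proj i : EuclideanSpace ℝ (Fin 3) →L[ℝ] ℝ) s :=
    (EuclideanSpace.proj i : EuclideanSpace ℝ (Fin 3) →L[ℝ] ℝ).hasFDerivAt
  have hnum := (((hproj 0).mul (hproj 2)).sub ((hproj 1).pow 2)).sqrt h2.ne'
  refine (hnum.mul ((hasDerivAt_inv h1).hasFDerivAt.comp s (hproj 1))).congr_fderiv ?_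
  ext v
  have hsq := Real.sq_sqrt h2.le
  simp only [Fin.isValue, Pi.sub_apply, Pi.mul_apply, Function.comp_apply, one_div, mul_inv_rev,
    Nat.add_one_sub_one, pow_one, nsmul_eq_mul, Nat.cast_ofNat, add_apply, smul_apply, sub_apply,
    ContinuousLinearMap.comp_apply, PiLp.proj_apply, ContinuousLinearMap.toSpanSingleton_apply,
    smul_eq_mul, mul_neg, smul_add, cvOfSumsDeriv]
  field_simp
  rw [hsq]
  ring

/-- The vector `(1, y, y²)`, whose mean is the vector of the first moments of a law. -/
noncomputable def powerVec (y : ℝ) : EuclideanSpace ℝ (Fin 3) := !₂[1, y, y ^ 2]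

lemma residualCV_eq_sqrt_mul (d : ℕ) (x : ℕ → ℝ) (n : ℕ) (t : ℝ) :
    residualCV d x n t =
      √(numExceedances x n t / (numExceedances x n t - d)) * residualCV 0 x n t := by
  unfold residualCV sdExcess
  rw [Nat.cast_zero, sub_zero]
  set N : ℝ := (numExceedances x n t : ℝ)
  set S := ∑ j ∈ exceedances x n t, ((x j - t) - meanExcess x n t) ^ 2
  rcases eq_or_ne (numExceedances x n t) 0 with h0 | h0
  · have hS : S = 0 := by simp [S, Finset.card_eq_zero.1 h0]
    simp [hS]
  have hN0 : 0 < N := by positivity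
  rw [← mul_div_assoc, mul_comm, ← Real.sqrt_mul (by positivity)]
  congr 2
  field_simp

lemma residualCV_zero_eq_cvOfSums (x : ℕ → ℝ) (n : ℕ) (t : ℝ) :
    residualCV 0 x n t = cvOfSums (∑ j ∈ exceedances x n t, powerVec (x j - t)) := by
  set s := ∑ j ∈ exceedances x n t, powerVec (x j - t)
  have h0 : s 0 = numExceedances x n t := by simp [s, powerVec, numExceedances]
  have h1 : s 1 = ∑ j ∈ exceedances x n t, (x j - t) := by simp [s, powerVec]
  have h2 : s 2 = ∑ j ∈ exceedances x n t, (x j - t) ^ 2 := by simp [s, powerVec]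
  have hmean : meanExcess x n t = s 1 / s 0 := by rw [meanExcess, h0, h1]
  rcases eq_or_ne (s 0) 0 with hz | hz
  · have : exceedances x n t = ∅ := by simpa [h0, numExceedances] using hz
    have hs1 : s 1 = 0 := by rw [h1, this, Finset.sum_empty]
    simp [residualCV, cvOfSums, hmean, hs1]
  have hpos : 0 < s 0 := lt_of_le_of_ne (h0 ▸ Nat.cast_nonneg _) hz.symm
  have hsq : ∑ j ∈ exceedances x n t, ((x j - t) - meanExcess x n t) ^ 2 =
      (s 0 * s 2 - s 1 ^ 2) / s 0 := by
    have hexp (j) : ((x j - t) - meanExcess x n t) ^ 2 =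
        (x j - t) ^ 2 - 2 * meanExcess x n t * (x j - t) + meanExcess x n t ^ 2 := by ring
    simp only [hexp]
    rw [Finset.sum_add_distrib, Finset.sum_sub_distrib, ← Finset.mul_sum, Finset.sum_const,
      nsmul_eq_mul, ← h1, ← h2, ← numExceedances, ← h0, hmean]
    field_simp
    ring
  rw [residualCV, sdExcess, hsq, hmean, ← h0, Nat.cast_zero, sub_zero, cvOfSums, div_div, ← pow_two,
    Real.sqrt_div' _ (by positivity), Real.sqrt_sq hpos.le, div_div_div_cancel_right₀ hz]

lemma tendsto_div_sub_const (d : ℝ) : Tendsto (fun x : ℝ => x / (x - d)) atTop (𝓝 1) := by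
  have h : Tendsto (fun x : ℝ => (1 - d * x⁻¹)⁻¹) atTop (𝓝 1) := by
    simpa using ((tendsto_inv_atTop_zero.const_mul d).const_sub 1).inv₀ (by simp)
  refine h.congr' ?_
  filter_upwards [eventually_ne_atTop 0] with x hx
  rw [← div_eq_mul_inv, one_sub_div hx, inv_div]

lemma tendsto_sqrt_mul_sqrt_div_sub_const_sub_one (d : ℝ) :
    Tendsto (fun x : ℝ => √x * (√(x / (x - d)) - 1)) atTop (𝓝 0) := by
  have hratio := (tendsto_div_sub_const d).sqrt
  have h : Tendsto (fun x : ℝ => d * (√x)⁻¹ * (x / (x - d)) / (√(x / (x - d)) + 1)) atTop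
      (𝓝 (d * 0 * 1 / (√1 + 1))) :=
    (((tendsto_inv_atTop_zero.comp Real.tendsto_sqrt_atTop).const_mul d).mul
      (tendsto_div_sub_const d)).div (hratio.add_const 1) (by positivity)
  rw [mul_zero, zero_mul, zero_div] at h
  refine h.congr' ?_
  filter_upwards [eventually_gt_atTop 0, eventually_gt_atTop d] with x hx hxd
  have hpos : 0 < x - d := sub_pos.2 hxd
  have hsq := Real.sq_sqrt (div_pos hx hpos).le
  calc d * (√x)⁻¹ * (x / (x - d)) / (√(x / (x - d)) + 1)
      = √x * (√(x / (x - d)) ^ 2 - 1) / (√(x / (x - d)) + 1) := by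
        rw [hsq]
        field_simp
        rw [Real.sq_sqrt hx.le]
        ring
    _ = √x * (√(x / (x - d)) - 1) := by
        field_simp
        ring

section ExcessLaw
variable {ν : Measure ℝ} {t : ℝ}

/-- The law of the excess `x - t` of a `ν`-distributed `x` over the threshold `t`, given that
`x > t`. It is the zero measure if `ν (Set.Ioi t) = 0`. -/
noncomputable def excessLaw (ν : Measure ℝ) (t : ℝ) : Measure ℝ :=
  (ν[|Set.Ioi t]).map fun x => x - t

lemma isProbabilityMeasure_excessLaw [IsFiniteMeasure ν] (ht : ν (Set.Ioi t) ≠ 0) :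
    IsProbabilityMeasure (excessLaw ν t) :=
  have := cond_isProbabilityMeasure ht
  Measure.isProbabilityMeasure_map (by fun_prop)

lemma ae_excessLaw_pos : ∀ᵐ y ∂excessLaw ν t, 0 < y := by
  refine (ae_map_iff (by fun_prop) measurableSet_Ioi).2 ?_
  filter_upwards [ae_cond_mem measurableSet_Ioi] with x hx using sub_pos.2 hx

lemma integral_excessLaw_pos [IsFiniteMeasure ν] (ht : ν (Set.Ioi t) ≠ 0)
    (hint : Integrable id (excessLaw ν t)) : 0 < ∫ y, y ∂excessLaw ν t := by
  have := isProbabilityMeasure_excessLaw ht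
  refine (integral_pos_iff_support_of_nonneg_ae (ae_excessLaw_pos.mono fun y hy => hy.le) hint).2 ?_
  have hsupp : Function.support (fun y : ℝ => y) =ᵐ[excessLaw ν t] Set.univ :=
    eventuallyEq_univ.2 (ae_excessLaw_pos.mono fun y hy => hy.ne')
  simp [measure_congr hsupp]

lemma memLp_indicator_Ioi_comp_sub [IsFiniteMeasure ν] {E : Type*} [NormedAddCommGroup E]
    (ht : ν (Set.Ioi t) ≠ 0) {h : ℝ → E} {q : ENNReal} (hh : MemLp h q (excessLaw ν t)) :
    MemLp ((Set.Ioi t).indicator fun x => h (x - t)) q ν := by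
  have hrestrict : ν.restrict (Set.Ioi t) = ν (Set.Ioi t) • ν[|Set.Ioi t] := by
    rw [ProbabilityTheory.cond, smul_smul, ENNReal.mul_inv_cancel ht (measure_ne_top _ _), one_smul]
  rw [memLp_indicator_iff_restrict measurableSet_Ioi, hrestrict]
  exact ((measurableEmbedding_subRight t).memLp_map_measure_iff.1 hh).smul_measure
    (measure_ne_top _ _)

lemma integral_indicator_Ioi_comp_sub [IsFiniteMeasure ν] {E : Type*} [NormedAddCommGroup E]
    [NormedSpace ℝ E] (ht : ν (Set.Ioi t) ≠ 0) (h : ℝ → E) :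
    ∫ x, (Set.Ioi t).indicator (fun x => h (x - t)) x ∂ν =
      ν.real (Set.Ioi t) • ∫ y, h y ∂excessLaw ν t := by
  have hp : ν.real (Set.Ioi t) ≠ 0 := (measureReal_ne_zero_iff).2 ht
  rw [excessLaw, (measurableEmbedding_subRight t).integral_map, ProbabilityTheory.cond,
    integral_smul_measure, integral_indicator measurableSet_Ioi, ENNReal.toReal_inv,
    ← measureReal_def, smul_inv_smul₀ hp]

lemma variance_indicator_Ioi_comp_sub [IsFiniteMeasure ν] (ht : ν (Set.Ioi t) ≠ 0) {h : ℝ → ℝ}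
    (hm : Measurable h) (h0 : ∫ y, h y ∂excessLaw ν t = 0) :
    Var[(Set.Ioi t).indicator fun x => h (x - t); ν] =
      ν.real (Set.Ioi t) * Var[h; excessLaw ν t] := by
  have hmean := integral_indicator_Ioi_comp_sub ht h
  rw [h0, smul_zero] at hmean
  have hm' : AEMeasurable ((Set.Ioi t).indicator fun x => h (x - t)) ν :=
    ((hm.comp (measurable_id.sub_const t)).indicator measurableSet_Ioi).aemeasurable
  rw [variance_of_integral_eq_zero hm' hmean, variance_of_integral_eq_zero hm.aemeasurable h0,
    ← smul_eq_mul, ← integral_indicator_Ioi_comp_sub ht fun y => h y ^ 2]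
  congr with x
  by_cases hx : x ∈ Set.Ioi t <;> simp [hx]

end ExcessLaw

section CoefficientOfVariation
variable {η : Measure ℝ}

/-- The coefficient of variation of the law `η`. -/
noncomputable def coeffVar (η : Measure ℝ) : ℝ := √(Var[id; η]) / ∫ y, y ∂η

/-- The influence function of the coefficient of variation at the law `η`. -/
noncomputable def cvInfluence (η : Measure ℝ) (y : ℝ) : ℝ :=
  cvOfSumsDeriv (∫ z, powerVec z ∂η) (powerVec y)

lemma measurable_powerVec : Measurable powerVec := by
  refine (WithLp.measurable_toLp 2 _).comp (measurable_pi_iff.2 fun i => ?_)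
  fin_cases i
  exacts [measurable_const, measurable_id, measurable_id.pow_const 2]

lemma measurable_cvInfluence : Measurable (cvInfluence η) :=
  (cvOfSumsDeriv _).continuous.measurable.comp measurable_powerVec

lemma memLp_powerVec [IsFiniteMeasure η] (hη : MemLp id 4 η) : MemLp powerVec 2 η := by
  have hsq : MemLp (fun y : ℝ => y ^ 2) 2 η := by
    refine (memLp_two_iff_integrable_sq (by fun_prop)).2 ?_
    simpa [← pow_mul, Even.pow_abs (⟨2, rfl⟩ : Even 4)] using hη.integrable_norm_pow (by norm_num)
  refine .of_eval_piLp fun i => ?_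
  fin_cases i
  · exact memLp_const 1
  · exact hη.mono_exponent (by norm_num)
  · exact hsq

lemma integral_powerVec [IsProbabilityMeasure η] (hη : MemLp id 2 η) :
    ∫ y, powerVec y ∂η = !₂[1, ∫ y, y ∂η, ∫ y, y ^ 2 ∂η] := by
  have hint (i : Fin 3) : Integrable (fun y => powerVec y i) η := by
    fin_cases i
    · exact integrable_const 1
    · exact hη.integrable one_le_two
    · exact hη.integrable_sq
  ext i
  rw [eval_integral_piLp hint]
  fin_cases i <;> simp [powerVec]

lemma cvOfSums_integral_powerVec [IsProbabilityMeasure η] (hη : MemLp id 2 η) :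
    cvOfSums (∫ y, powerVec y ∂η) = coeffVar η := by
  rw [integral_powerVec hη, coeffVar, variance_eq_sub hη]
  simp [cvOfSums]

lemma hasFDerivAt_cvOfSums_smul_integral_powerVec [IsProbabilityMeasure η] (hη : MemLp id 2 η)
    (hmean : ∫ y, y ∂η ≠ 0) (hvar : Var[id; η] ≠ 0) {r : ℝ} (hr : r ≠ 0) :
    HasFDerivAt cvOfSums (cvOfSumsDeriv (r • ∫ y, powerVec y ∂η)) (r • ∫ y, powerVec y ∂η) := by
  have hvar_pos : 0 < r ^ 2 * Var[id; η] :=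
    mul_pos (by positivity) ((variance_nonneg _ _).lt_of_ne' hvar)
  rw [integral_powerVec hη]
  refine hasFDerivAt_cvOfSums (by simp [hr, hmean]) (hvar_pos.trans_eq ?_)
  rw [variance_eq_sub hη]
  change r ^ 2 * (∫ y, y ^ 2 ∂η - (∫ y, y ∂η) ^ 2) =
    r * 1 * (r * ∫ y, y ^ 2 ∂η) - (r * ∫ y, y ∂η) ^ 2
  ring

lemma integral_cvInfluence [IsProbabilityMeasure η] (hη : MemLp id 4 η) :
    ∫ y, cvInfluence η y ∂η = 0 := by
  simp only [cvInfluence]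
  rw [ContinuousLinearMap.integral_comp_comm _ ((memLp_powerVec hη).integrable one_le_two),
    cvOfSumsDeriv_self]

lemma cvInfluence_eq [IsProbabilityMeasure η] (hη : MemLp id 2 η) (y : ℝ) :
    cvInfluence η y = (2 * √(Var[id; η]) * (∫ z, z ∂η) ^ 2)⁻¹ *
      ((∫ z, z ∂η) * y ^ 2 - 2 * (∫ z, z ^ 2 ∂η) * y + (∫ z, z ∂η) * ∫ z, z ^ 2 ∂η) := by
  rw [cvInfluence, integral_powerVec hη, variance_eq_sub hη, cvOfSumsDeriv_apply]
  simp only [powerVec, Matrix.cons_val, mul_one, one_mul, Pi.pow_apply, id_eq]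
  ring

lemma variance_cvInfluence [IsProbabilityMeasure η] (hη : MemLp id 4 η) {m : ℕ → ℝ}
    (hm : ∀ k ≤ 4, ∫ y, y ^ k ∂η = m k) :
    Var[cvInfluence η; η] =
      (m 1 ^ 2 * m 4 - 4 * m 1 * m 2 * m 3 + 4 * m 2 ^ 3 - m 1 ^ 2 * m 2 ^ 2) /
        (4 * Var[id; η] * m 1 ^ 4) := by
  have hη2 : MemLp id 2 η := hη.mono_exponent (by norm_num)
  have hint (k : ℕ) (hk : k ≤ 4) : Integrable (fun y : ℝ => y ^ k) η := by
    have hk' : (k : ENNReal) ≤ 4 := by exact_mod_cast hk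
    refine (integrable_norm_iff (by fun_prop)).1 ?_
    simpa only [norm_pow, id_eq] using (hη.mono_exponent hk').integrable_norm_pow'
  have hm0 : m 0 = 1 := by simpa using (hm 0 (by norm_num)).symm
  have hm1 : ∫ y, y ∂η = m 1 := by simpa using hm 1 (by norm_num)
  have hm2 : ∫ y, y ^ 2 ∂η = m 2 := hm 2 (by norm_num)
  have hquad : ∫ y, (m 1 * y ^ 2 - 2 * m 2 * y + m 1 * m 2) ^ 2 ∂η =
      m 1 ^ 2 * m 4 - 4 * m 1 * m 2 * m 3 + 4 * m 2 ^ 3 - m 1 ^ 2 * m 2 ^ 2 := by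
    have h0 := hint 0 (by norm_num)
    have h1 := hint 1 (by norm_num)
    have h2 := hint 2 (by norm_num)
    have h3 := hint 3 (by norm_num)
    have h4 := hint 4 (by norm_num)
    have hexp (y : ℝ) : (m 1 * y ^ 2 - 2 * m 2 * y + m 1 * m 2) ^ 2 =
        m 1 ^ 2 * y ^ 4 - 4 * m 1 * m 2 * y ^ 3 + (4 * m 2 ^ 2 + 2 * m 1 ^ 2 * m 2) * y ^ 2 -
          4 * m 1 * m 2 ^ 2 * y ^ 1 + m 1 ^ 2 * m 2 ^ 2 * y ^ 0 := by ring
    simp only [hexp]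
    rw [integral_add (by fun_prop) (by fun_prop), integral_sub (by fun_prop) (by fun_prop),
      integral_add (by fun_prop) (by fun_prop), integral_sub (by fun_prop) (by fun_prop)]
    simp only [integral_const_mul]
    rw [hm 4 le_rfl, hm 3 (by norm_num), hm 2 (by norm_num), hm 1 (by norm_num),
      hm 0 (by norm_num), hm0]
    ring
  rw [variance_of_integral_eq_zero measurable_cvInfluence.aemeasurable (integral_cvInfluence hη)]
  simp only [cvInfluence_eq hη2, hm1, hm2, mul_pow, inv_pow, Real.sq_sqrt (variance_nonneg _ _)]
  rw [integral_const_mul, hquad]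
  ring

end CoefficientOfVariation

section ExcessVec
variable {ν : Measure ℝ} {t : ℝ}

/-- The vector that an observation `x` contributes to the power sums of the excesses over `t`. -/
noncomputable def excessVec (t : ℝ) : ℝ → EuclideanSpace ℝ (Fin 3) :=
  (Set.Ioi t).indicator fun x => powerVec (x - t)

lemma sum_excessVec (x : ℕ → ℝ) (n : ℕ) (t : ℝ) :
    ∑ j ∈ Finset.range n, excessVec t (x j) = ∑ j ∈ exceedances x n t, powerVec (x j - t) := by
  simp [excessVec, exceedances, Finset.sum_filter, Set.indicator_apply]

lemma measurable_excessVec : Measurable (excessVec t) :=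
  (measurable_powerVec.comp (measurable_id.sub_const t)).indicator measurableSet_Ioi

lemma variance_cvOfSumsDeriv_excessVec [IsFiniteMeasure ν] (ht : ν (Set.Ioi t) ≠ 0)
    (hη : MemLp id 4 (excessLaw ν t)) :
    Var[fun x => cvOfSumsDeriv (ν.real (Set.Ioi t) • ∫ y, powerVec y ∂excessLaw ν t)
      (excessVec t x); ν] =
      (ν.real (Set.Ioi t))⁻¹ * Var[cvInfluence (excessLaw ν t); excessLaw ν t] := by
  have := isProbabilityMeasure_excessLaw ht
  have hp : 0 < ν.real (Set.Ioi t) := ENNReal.toReal_pos ht (measure_ne_top _ _)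
  have hlin : (fun x => cvOfSumsDeriv (ν.real (Set.Ioi t) • ∫ y, powerVec y ∂excessLaw ν t)
      (excessVec t x)) = fun x => (ν.real (Set.Ioi t))⁻¹ *
        (Set.Ioi t).indicator (fun x => cvInfluence (excessLaw ν t) (x - t)) x := by
    ext x
    by_cases hx : x ∈ Set.Ioi t <;> simp [excessVec, hx, cvOfSumsDeriv_smul hp, cvInfluence]
  rw [hlin, variance_const_mul,
    variance_indicator_Ioi_comp_sub ht measurable_cvInfluence (integral_cvInfluence hη)]
  field_simp

end ExcessVec

section ResidualCV
variable {Ω : Type*} [MeasurableSpace Ω] {P : Measure Ω}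
  {X : ℕ → Ω → ℝ} {ν : Measure ℝ} [IsProbabilityMeasure ν] {t : ℝ}

lemma numExceedances_eq_sum (x : ℕ → ℝ) (n : ℕ) (t : ℝ) :
    (numExceedances x n t : ℝ) = ∑ j ∈ Finset.range n, (Set.Ioi t).indicator 1 (x j) := by
  rw [numExceedances, exceedances, Finset.natCast_card_filter]
  simp only [Set.indicator_apply, Set.mem_Ioi, Pi.one_apply]

lemma tendsto_ae_numExceedances_div (hX : ∀ j, HasLaw (X j) ν P) (hindep : iIndepFun X P) (t : ℝ) :
    ∀ᵐ ω ∂P, Tendsto (fun n : ℕ => (numExceedances (fun j => X j ω) n t : ℝ) / n) atTop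
      (𝓝 (ν.real (Set.Ioi t))) := by
  have hm : Measurable ((Set.Ioi t).indicator (1 : ℝ → ℝ)) :=
    measurable_const.indicator measurableSet_Ioi
  have hmean : ∫ ω, (Set.Ioi t).indicator (1 : ℝ → ℝ) (X 0 ω) ∂P = ν.real (Set.Ioi t) := by
    rw [← integral_indicator_one measurableSet_Ioi, ← (hX 0).integral_comp hm.aestronglyMeasurable]
    rfl
  have hint : Integrable ((Set.Ioi t).indicator (1 : ℝ → ℝ)) ν :=
    (integrable_const 1).indicator measurableSet_Ioi
  have hident (j : ℕ) : IdentDistrib (X j) (X 0) P P := (hX j).identDistrib (hX 0)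
  have hlln := strong_law_ae_real (fun j ω => (Set.Ioi t).indicator (1 : ℝ → ℝ) (X j ω))
    (((hX 0).map_eq.symm ▸ hint).comp_aemeasurable (hX 0).aemeasurable)
    (fun i j hij => (hindep.indepFun hij).comp hm hm) fun j => (hident j).comp hm
  simpa only [hmean, numExceedances_eq_sum] using hlln

lemma aemeasurable_numExceedances (hX : ∀ j, AEMeasurable (X j) P) (n : ℕ) (t : ℝ) :
    AEMeasurable (fun ω => (numExceedances (fun j => X j ω) n t : ℝ)) P := by
  simp only [numExceedances_eq_sum]
  exact Finset.aemeasurable_fun_sum _ fun j _ =>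
    (measurable_const.indicator measurableSet_Ioi).comp_aemeasurable (hX j)

lemma tendsto_ae_numExceedances_atTop (hX : ∀ j, HasLaw (X j) ν P) (hindep : iIndepFun X P)
    (ht : ν (Set.Ioi t) ≠ 0) :
    ∀ᵐ ω ∂P, Tendsto (fun n : ℕ => (numExceedances (fun j => X j ω) n t : ℝ)) atTop atTop := by
  have hp : 0 < ν.real (Set.Ioi t) := ENNReal.toReal_pos ht (measure_ne_top _ _)
  filter_upwards [tendsto_ae_numExceedances_div hX hindep t] with ω hω
  refine (hω.pos_mul_atTop hp tendsto_natCast_atTop_atTop).congr' ?_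
  filter_upwards [eventually_ne_atTop 0] with n hn
  exact div_mul_cancel₀ _ (Nat.cast_ne_zero.2 hn)

lemma sqrt_mul_residualCV_sub (d : ℕ) (x : ℕ → ℝ) (n : ℕ) (t c : ℝ) :
    √(numExceedances x n t : ℝ) * (residualCV d x n t - c) =
      √(numExceedances x n t / (numExceedances x n t - d)) * √(numExceedances x n t / n) *
        (√n * (residualCV 0 x n t - c)) +
      c * (√(numExceedances x n t : ℝ) *
        (√(numExceedances x n t / (numExceedances x n t - d)) - 1)) := by
  rcases eq_or_ne n 0 with rfl | hn
  · simp [numExceedances, exceedances]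
  have hsqrt : √(numExceedances x n t : ℝ) = √(numExceedances x n t / n) * √n := by
    rw [← Real.sqrt_mul (by positivity), div_mul_cancel₀ _ (by positivity)]
  rw [residualCV_eq_sqrt_mul d, hsqrt]
  ring

lemma hasLaw_inv_sqrt_mul_gaussianReal {Ω : Type*} [MeasurableSpace Ω] {P : Measure Ω} {Y : Ω → ℝ}
    {v : ℝ} (hY : HasLaw Y (gaussianReal 0 v.toNNReal) P) {p : ℝ} (hp : 0 < p) :
    HasLaw (fun ω => (√p)⁻¹ * Y ω) (gaussianReal 0 (p⁻¹ * v).toNNReal) P := by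
  convert gaussianReal_const_mul hY (√p)⁻¹ using 2
  · rw [mul_zero]
  · rw [Real.toNNReal_mul (by positivity)]
    congr 1
    ext
    simp [hp.le]

variable [IsProbabilityMeasure P] {Ω' : Type*} [MeasurableSpace Ω'] {P' : Measure Ω'}
  [IsProbabilityMeasure P'] {Y : Ω' → ℝ}

lemma tendstoInDistribution_sqrt_mul_residualCV_zero_sub (hX : ∀ j, HasLaw (X j) ν P)
    (hindep : iIndepFun X P) (ht : ν (Set.Ioi t) ≠ 0) (hη : MemLp id 4 (excessLaw ν t))
    (hvar : Var[id; excessLaw ν t] ≠ 0)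
    (hY : HasLaw Y (gaussianReal 0
      ((ν.real (Set.Ioi t))⁻¹ * Var[cvInfluence (excessLaw ν t); excessLaw ν t]).toNNReal) P') :
    TendstoInDistribution
      (fun (n : ℕ) ω => √n * (residualCV 0 (fun j => X j ω) n t - coeffVar (excessLaw ν t)))
      atTop Y (fun _ => P) P' := by
  have := isProbabilityMeasure_excessLaw ht
  set η := excessLaw ν t
  set p := ν.real (Set.Ioi t)
  have hp : 0 < p := ENNReal.toReal_pos ht (measure_ne_top _ _)
  have hη2 : MemLp id 2 η := hη.mono_exponent (by norm_num)
  have hident : IdentDistrib (excessVec t ∘ X 0) (excessVec t) P ν :=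
    ((hX 0).identDistrib .id).comp measurable_excessVec
  have hL2 : MemLp (excessVec t ∘ X 0) 2 P :=
    hident.memLp_iff.2 (memLp_indicator_Ioi_comp_sub ht (memLp_powerVec hη))
  have hmean : P[excessVec t ∘ X 0] = p • ∫ y, powerVec y ∂η :=
    hident.integral_eq.trans (integral_indicator_Ioi_comp_sub ht powerVec)
  have hderiv : HasFDerivAt cvOfSums (cvOfSumsDeriv (p • ∫ y, powerVec y ∂η))
      P[excessVec t ∘ X 0] := by
    rw [hmean]
    exact hasFDerivAt_cvOfSums_smul_integral_powerVec hη2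
      (integral_excessLaw_pos ht (hη2.integrable one_le_two)).ne' hvar hp.ne'
  have hvarf : Var[fun ω => cvOfSumsDeriv (p • ∫ y, powerVec y ∂η) (excessVec t (X 0 ω)); P] =
      p⁻¹ * Var[cvInfluence η; η] :=
    (hident.comp (cvOfSumsDeriv _).continuous.measurable).variance_eq.trans
      (variance_cvOfSumsDeriv_excessVec ht hη)
  have hdelta := tendstoInDistribution_delta_method (V := fun j => excessVec t ∘ X j) (Y := Y)
    (P' := P') hL2 (hindep.comp (fun _ => excessVec t) fun _ => measurable_excessVec)
    (fun j => ((hX j).identDistrib (hX 0)).comp measurable_excessVec) measurable_cvOfSums hderiv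
    (by simpa only [Function.comp_apply, hvarf] using hY)
  refine hdelta.congr (fun n => ae_of_all _ fun ω => ?_) .rfl
  rcases eq_or_ne n 0 with rfl | hn
  · simp
  rw [hmean, cvOfSums_smul hp, cvOfSums_integral_powerVec hη2, cvOfSums_smul (by positivity)]
  simp only [Function.comp_apply]
  rw [sum_excessVec fun j => X j ω, residualCV_zero_eq_cvOfSums]

theorem tendstoInDistribution_residualCV (hX : ∀ j, HasLaw (X j) ν P)
    (hindep : iIndepFun X P) (ht : ν (Set.Ioi t) ≠ 0) (hη : MemLp id 4 (excessLaw ν t))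
    (hvar : Var[id; excessLaw ν t] ≠ 0) (d : ℕ)
    (hY : HasLaw Y (gaussianReal 0
      Var[cvInfluence (excessLaw ν t); excessLaw ν t].toNNReal) P') :
    TendstoInDistribution
      (fun (n : ℕ) ω => √(numExceedances (fun j => X j ω) n t : ℝ) *
        (residualCV d (fun j => X j ω) n t - coeffVar (excessLaw ν t)))
      atTop Y (fun _ => P) P' := by
  set c := coeffVar (excessLaw ν t)
  set p := ν.real (Set.Ioi t)
  have hp : 0 < p := ENNReal.toReal_pos ht (measure_ne_top _ _)
  set N : ℕ → Ω → ℝ := fun n ω => numExceedances (fun j => X j ω) n t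
  set ratio : ℕ → Ω → ℝ := fun n ω => √(N n ω / (N n ω - d))
  have hN (n : ℕ) : AEMeasurable (N n) P :=
    aemeasurable_numExceedances (fun j => (hX j).aemeasurable) n t
  have hcoef : ∀ᵐ ω ∂P, Tendsto
      (fun n => (ratio n ω * √(N n ω / n), c * (√(N n ω) * (ratio n ω - 1)))) atTop
      (𝓝 (√p, 0)) := by
    filter_upwards [tendsto_ae_numExceedances_div hX hindep t,
      tendsto_ae_numExceedances_atTop hX hindep ht] with ω hω hNtop
    have hratio := ((tendsto_div_sub_const d).comp hNtop).sqrt.mul hω.sqrt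
    have hcorr := ((tendsto_sqrt_mul_sqrt_div_sub_const_sub_one d).comp hNtop).const_mul c
    simpa only [Function.comp_apply, Real.sqrt_one, one_mul, mul_zero] using
      hratio.prodMk_nhds hcorr
  have hslutsky := (tendstoInDistribution_sqrt_mul_residualCV_zero_sub hX hindep ht hη hvar
    (hasLaw_inv_sqrt_mul_gaussianReal hY hp)).continuous_comp_prodMk_of_tendstoInMeasure_const
    (g := fun u : ℝ × ℝ × ℝ => u.2.1 * u.1 + u.2.2) (by fun_prop)
    (tendstoInMeasure_of_tendsto_ae (fun n => ?_) hcoef) fun n => ?_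
  · refine hslutsky.congr (fun n => ae_of_all _ fun ω => ?_) (ae_of_all _ fun ω => ?_)
    · exact (sqrt_mul_residualCV_sub d (fun j => X j ω) n t c).symm
    · simp only [p, add_zero, mul_inv_cancel_left₀ (Real.sqrt_pos.2 hp).ne']
  · fun_prop
  · fun_prop

end ResidualCV

section Quantile

/-- The increasing function that transports the standard exponential law to `GPD(ξ, ψ)`. -/
noncomputable def gpdOfExp (ξ ψ u : ℝ) : ℝ :=
  if ξ = 0 then ψ * u else ψ * (Real.exp (ξ * u) - 1) / ξ

/-- The inverse of `gpdOfExp`, on the range `0 < 1 + ξ x / ψ`. -/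
noncomputable def expOfGPD (ξ ψ x : ℝ) : ℝ :=
  if ξ = 0 then x / ψ else Real.log (1 + ξ * x / ψ) / ξ

variable {ξ ψ : ℝ}

lemma gpdOfExp_zero (ξ ψ : ℝ) : gpdOfExp ξ ψ 0 = 0 := by simp [gpdOfExp]

lemma expOfGPD_zero (ξ ψ : ℝ) : expOfGPD ξ ψ 0 = 0 := by simp [expOfGPD]

lemma add_mul_gpdOfExp (ξ ψ u : ℝ) : ψ + ξ * gpdOfExp ξ ψ u = ψ * Real.exp (ξ * u) := by
  unfold gpdOfExp
  split_ifs with h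
  · simp [h]
  · field_simp
    ring

lemma hasDerivAt_gpdOfExp (ξ ψ u : ℝ) :
    HasDerivAt (gpdOfExp ξ ψ) (ψ + ξ * gpdOfExp ξ ψ u) u := by
  rw [add_mul_gpdOfExp]
  rcases eq_or_ne ξ 0 with rfl | h
  · have hf : gpdOfExp 0 ψ = fun u => ψ * u := by
      ext
      simp [gpdOfExp]
    rw [hf]
    simpa using (hasDerivAt_id u).const_mul ψ
  · have hf : gpdOfExp ξ ψ = fun u => ψ * (Real.exp (ξ * u) - 1) / ξ := by
      ext
      simp [gpdOfExp, h]
    rw [hf]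
    convert! (((((hasDerivAt_id u).const_mul ξ).exp).sub_const 1).const_mul ψ).div_const ξ using 1
    simp only [id]
    field_simp

lemma continuous_gpdOfExp (ξ ψ : ℝ) : Continuous (gpdOfExp ξ ψ) :=
  continuous_iff_continuousAt.2 fun u => (hasDerivAt_gpdOfExp ξ ψ u).continuousAt

lemma strictMono_gpdOfExp (ξ : ℝ) (hψ : 0 < ψ) : StrictMono (gpdOfExp ξ ψ) := by
  refine strictMono_of_deriv_pos fun u => ?_
  rw [(hasDerivAt_gpdOfExp ξ ψ u).deriv, add_mul_gpdOfExp]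
  positivity

lemma gpdOfExp_nonneg (ξ : ℝ) (hψ : 0 < ψ) {u : ℝ} (hu : 0 ≤ u) : 0 ≤ gpdOfExp ξ ψ u := by
  rw [← gpdOfExp_zero ξ ψ]
  exact (strictMono_gpdOfExp ξ hψ).monotone hu

lemma gpdOfExp_le (ξ : ℝ) (hψ : 0 < ψ) (u : ℝ) :
    gpdOfExp ξ ψ u ≤ ψ * (u * Real.exp (max ξ 0 * u)) := by
  unfold gpdOfExp
  split_ifs with h
  · simp [h]
  rw [mul_div_assoc]
  refine mul_le_mul_of_nonneg_left ?_ hψ.le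
  rcases lt_or_gt_of_ne h with h | h
  · rw [max_eq_right h.le, zero_mul, Real.exp_zero, mul_one, div_le_iff_of_neg h]
    linarith [Real.add_one_le_exp (ξ * u)]
  · rw [max_eq_left h.le, div_le_iff₀ h]
    have hexp : (1 - ξ * u) * Real.exp (ξ * u) ≤ Real.exp (-(ξ * u)) * Real.exp (ξ * u) := by
      gcongr
      exact Real.one_sub_le_exp_neg _
    rw [← Real.exp_add, neg_add_cancel, Real.exp_zero] at hexp
    linarith

lemma gpdOfExp_expOfGPD {x : ℝ} (hψ : ψ ≠ 0) (hx : 0 < 1 + ξ * x / ψ) :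
    gpdOfExp ξ ψ (expOfGPD ξ ψ x) = x := by
  unfold gpdOfExp expOfGPD
  split_ifs with h
  · field_simp
  · rw [mul_div_cancel₀ _ h, Real.exp_log hx]
    field_simp
    ring

lemma preimage_gpdOfExp_Iic (hψ : 0 < ψ) {x : ℝ} (hx : 0 < 1 + ξ * x / ψ) :
    gpdOfExp ξ ψ ⁻¹' Set.Iic x = Set.Iic (expOfGPD ξ ψ x) := by
  ext u
  rw [Set.mem_preimage, Set.mem_Iic, Set.mem_Iic,
    ← (strictMono_gpdOfExp ξ hψ).le_iff_le (b := expOfGPD ξ ψ x), gpdOfExp_expOfGPD hψ.ne' hx]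

lemma gpdOfExp_lt_of_one_add_nonpos (hψ : 0 < ψ) {x : ℝ} (hx0 : 0 < x) (hx : 1 + ξ * x / ψ ≤ 0)
    (u : ℝ) : gpdOfExp ξ ψ u < x := by
  have hend : ψ + ξ * x ≤ 0 := by
    have h := mul_nonpos_of_nonneg_of_nonpos hψ.le hx
    rwa [mul_add, mul_one, mul_div_cancel₀ _ hψ.ne'] at h
  have hξ : ξ < 0 := by
    by_contra! h
    nlinarith [mul_nonneg h hx0.le]
  have hpos : 0 < ψ + ξ * gpdOfExp ξ ψ u := by
    rw [add_mul_gpdOfExp]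
    positivity
  exact (mul_lt_mul_left_of_neg hξ).1 (by linarith)

lemma expOfGPD_nonneg {x : ℝ} (hψ : 0 < ψ) (hx0 : 0 ≤ x) (hx : 0 < 1 + ξ * x / ψ) :
    0 ≤ expOfGPD ξ ψ x := by
  rwa [← (strictMono_gpdOfExp ξ hψ).le_iff_le, gpdOfExp_zero, gpdOfExp_expOfGPD hψ.ne' hx]

lemma gpdCDF_eq_one_sub_exp {x : ℝ} (hx0 : 0 ≤ x) (hx : 0 < 1 + ξ * x / ψ) :
    gpdCDF ξ ψ x = 1 - Real.exp (-expOfGPD ξ ψ x) := by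
  rcases hx0.eq_or_lt with rfl | hx0
  · simp [gpdCDF, expOfGPD_zero]
  rw [gpdCDF, expOfGPD, if_neg hx0.not_ge, if_neg hx.not_ge, Real.rpow_def_of_pos hx]
  split_ifs
  · rw [neg_div]
  · congr 2
    ring

lemma gpdCDF_eq_one {x : ℝ} (hx0 : 0 < x) (hx : 1 + ξ * x / ψ ≤ 0) : gpdCDF ξ ψ x = 1 := by
  have hξ : ξ ≠ 0 := by
    rintro rfl
    norm_num at hx
  rw [gpdCDF, if_neg hx0.not_ge, if_neg hξ, if_pos hx]

lemma IsGPD.eq_map_expMeasure {ν : Measure ℝ} (hψ : 0 < ψ) (hν : IsGPD ξ ψ ν) :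
    ν = (expMeasure 1).map (gpdOfExp ξ ψ) := by
  have := hν.1
  have := isProbabilityMeasure_expMeasure one_pos
  have hmeas : Measurable (gpdOfExp ξ ψ) := (continuous_gpdOfExp ξ ψ).measurable
  have := Measure.isProbabilityMeasure_map (μ := expMeasure 1) hmeas.aemeasurable
  refine Measure.eq_of_cdf _ _ (StieltjesFunction.ext fun x => ?_)
  rw [hν.2 x, cdf_eq_real, map_measureReal_apply hmeas measurableSet_Iic]
  rcases le_or_gt x 0 with hx0 | hx0
  · have hsub : gpdOfExp ξ ψ ⁻¹' Set.Iic x ⊆ Set.Iic 0 := fun u hu =>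
      (strictMono_gpdOfExp ξ hψ).le_iff_le.1 ((hu.trans hx0).trans_eq (gpdOfExp_zero ξ ψ).symm)
    have hzero : (expMeasure 1).real (Set.Iic 0) = 0 := by
      rw [← cdf_eq_real, cdf_expMeasure_eq one_pos]
      simp
    rw [measureReal_mono_null hsub hzero, gpdCDF, if_pos hx0]
  rcases lt_or_ge 0 (1 + ξ * x / ψ) with hx | hx
  · rw [preimage_gpdOfExp_Iic hψ hx, ← cdf_eq_real, cdf_expMeasure_eq one_pos, one_mul,
      if_pos (expOfGPD_nonneg hψ hx0.le hx), gpdCDF_eq_one_sub_exp hx0.le hx]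
  · have huniv : gpdOfExp ξ ψ ⁻¹' Set.Iic x = Set.univ :=
      Set.eq_univ_of_forall fun u => (gpdOfExp_lt_of_one_add_nonpos hψ hx0 hx u).le
    rw [huniv, probReal_univ, gpdCDF_eq_one hx0 hx]

end Quantile

section Threshold
variable {ξ ψ t : ℝ}

lemma one_add_mul_add_div (hψ : ψ ≠ 0) (htop : ψ + ξ * t ≠ 0) (x : ℝ) :
    1 + ξ * (t + x) / ψ = (1 + ξ * t / ψ) * (1 + ξ * x / (ψ + ξ * t)) := by
  field_simp
  ring

lemma expOfGPD_add (hψ : ψ ≠ 0) {x : ℝ} (htop : ψ + ξ * t ≠ 0) (ht : 1 + ξ * t / ψ ≠ 0)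
    (hx : 1 + ξ * x / (ψ + ξ * t) ≠ 0) :
    expOfGPD ξ ψ (t + x) = expOfGPD ξ ψ t + expOfGPD ξ (ψ + ξ * t) x := by
  unfold expOfGPD
  split_ifs with h
  · simp only [h, zero_mul, add_zero]
    ring
  · rw [one_add_mul_add_div hψ htop, Real.log_mul ht hx, add_div]

lemma one_sub_gpdCDF_add (hψ : 0 < ψ) (ht : 0 ≤ t) (htop : 0 < ψ + ξ * t) {x : ℝ} (hx : 0 ≤ x) :
    1 - gpdCDF ξ ψ (t + x) = (1 - gpdCDF ξ ψ t) * (1 - gpdCDF ξ (ψ + ξ * t) x) := by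
  have hfac := one_add_mul_add_div hψ.ne' htop.ne' x
  have ht1 : 0 < 1 + ξ * t / ψ := by
    rw [one_add_div hψ.ne']
    positivity
  rcases lt_or_ge 0 (1 + ξ * x / (ψ + ξ * t)) with h | h
  · rw [gpdCDF_eq_one_sub_exp ht ht1, gpdCDF_eq_one_sub_exp hx h,
      gpdCDF_eq_one_sub_exp (add_nonneg ht hx) (hfac ▸ mul_pos ht1 h),
      expOfGPD_add hψ.ne' htop.ne' ht1.ne' h.ne', neg_add, Real.exp_add]
    ring
  · have hx0 : 0 < x := hx.lt_of_ne fun h0 => by norm_num [← h0] at h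
    rw [gpdCDF_eq_one hx0 h, gpdCDF_eq_one (add_pos_of_nonneg_of_pos ht hx0)
      (hfac ▸ mul_nonpos_of_nonneg_of_nonpos ht1.le h)]
    ring

lemma measureReal_Ioi_eq_one_sub_cdf (ν : Measure ℝ) [IsProbabilityMeasure ν] (x : ℝ) :
    ν.real (Set.Ioi x) = 1 - cdf ν x := by
  rw [cdf_eq_real, ← Set.compl_Iic, probReal_compl_eq_one_sub measurableSet_Iic]

lemma measureReal_excessLaw_Ioi (ν : Measure ℝ) (t : ℝ) {x : ℝ} (hx : 0 ≤ x) :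
    (excessLaw ν t).real (Set.Ioi x) = (ν.real (Set.Ioi t))⁻¹ * ν.real (Set.Ioi (t + x)) := by
  have hinter : Set.Ioi t ∩ (fun y => y - t) ⁻¹' Set.Ioi x = Set.Ioi (t + x) := by
    ext y
    simp only [Set.mem_inter_iff, Set.mem_preimage, Set.mem_Ioi]
    grind
  rw [excessLaw, map_measureReal_apply (by fun_prop) measurableSet_Ioi,
    measureReal_def, cond_apply measurableSet_Ioi, hinter, ENNReal.toReal_mul, ENNReal.toReal_inv]
  rfl

lemma IsGPD.measure_Ioi_ne_zero {ν : Measure ℝ} (hν : IsGPD ξ ψ ν) (hψ : 0 < ψ) (ht : 0 ≤ t)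
    (htop : 0 < ψ + ξ * t) : ν (Set.Ioi t) ≠ 0 := by
  have := hν.1
  have ht1 : 0 < 1 + ξ * t / ψ := by
    rw [one_add_div hψ.ne']
    positivity
  rw [← measureReal_ne_zero_iff, measureReal_Ioi_eq_one_sub_cdf, hν.2 t,
    gpdCDF_eq_one_sub_exp ht ht1, sub_sub_cancel]
  positivity

lemma IsGPD.excessLaw {ν : Measure ℝ} (hν : IsGPD ξ ψ ν) (hψ : 0 < ψ) (ht : 0 ≤ t)
    (htop : 0 < ψ + ξ * t) : IsGPD ξ (ψ + ξ * t) (excessLaw ν t) := by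
  have := hν.1
  have hpos := hν.measure_Ioi_ne_zero hψ ht htop
  have := isProbabilityMeasure_excessLaw hpos
  refine ⟨this, fun x => ?_⟩
  rcases lt_or_ge x 0 with hx | hx
  · rw [gpdCDF, if_pos hx.le, cdf_eq_real, measureReal_eq_zero_iff]
    exact measure_mono_null (fun y hy => (hy.trans_lt hx).not_gt) (ae_iff.1 ae_excessLaw_pos)
  · have hsurv := measureReal_excessLaw_Ioi ν t hx
    have hpos' := (measureReal_ne_zero_iff (by finiteness)).2 hpos
    simp only [measureReal_Ioi_eq_one_sub_cdf, hν.2] at hsurv hpos'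
    rw [one_sub_gpdCDF_add hψ ht htop hx, inv_mul_cancel_left₀ hpos'] at hsurv
    linarith

end Threshold

section Moments
variable {ξ ψ : ℝ} {k : ℕ}

lemma natCast_mul_lt_one_of_le {j : ℕ} (hjk : j ≤ k) (hk : k * ξ < 1) : j * ξ < 1 := by
  rcases le_or_gt ξ 0 with h | h
  · exact (mul_nonpos_of_nonneg_of_nonpos j.cast_nonneg h).trans_lt one_pos
  · exact (mul_le_mul_of_nonneg_right (Nat.cast_le.2 hjk) h.le).trans_lt hk

lemma isBigO_gpdOfExp_pow_mul_exp_neg (hψ : 0 < ψ) :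
    (fun u => gpdOfExp ξ ψ u ^ k * Real.exp (-u)) =O[atTop]
      fun u => u ^ k * Real.exp (-(1 - k * max ξ 0) * u) := by
  refine Asymptotics.IsBigO.of_bound (ψ ^ k) ?_
  filter_upwards [eventually_ge_atTop 0] with u hu
  have hq := gpdOfExp_nonneg ξ hψ hu
  rw [Real.norm_of_nonneg (by positivity), Real.norm_of_nonneg (by positivity)]
  calc gpdOfExp ξ ψ u ^ k * Real.exp (-u)
      ≤ (ψ * (u * Real.exp (max ξ 0 * u))) ^ k * Real.exp (-u) := by
        gcongr
        exact gpdOfExp_le ξ hψ u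
    _ = ψ ^ k * (u ^ k * Real.exp (-(1 - k * max ξ 0) * u)) := by
        rw [mul_pow, mul_pow, ← Real.exp_nat_mul, mul_assoc, mul_assoc, ← Real.exp_add]
        ring_nf

lemma exists_isBigO_gpdOfExp_pow_mul_exp_neg (hψ : 0 < ψ) (hk : k * ξ < 1) :
    ∃ b > 0, (fun u => gpdOfExp ξ ψ u ^ k * Real.exp (-u)) =O[atTop]
      fun u => Real.exp (-b * u) := by
  set β : ℝ := 1 - k * max ξ 0 with hβdef
  have hβ : 0 < β := by
    rcases max_cases ξ 0 with h | h <;> rw [hβdef, h.1] <;> linarith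
  refine ⟨β / 2, by positivity, (isBigO_gpdOfExp_pow_mul_exp_neg hψ).trans ?_⟩
  refine ((isLittleO_pow_exp_pos_mul_atTop k (half_pos hβ)).isBigO.mul
    (Asymptotics.isBigO_refl (fun u => Real.exp (-β * u)) atTop)).congr_right fun u => ?_
  rw [← Real.exp_add]
  ring_nf

lemma integrableOn_gpdOfExp_pow_mul_exp_neg (hψ : 0 < ψ) (hk : k * ξ < 1) :
    IntegrableOn (fun u => gpdOfExp ξ ψ u ^ k * Real.exp (-u)) (Set.Ioi 0) := by
  obtain ⟨b, hb, h⟩ := exists_isBigO_gpdOfExp_pow_mul_exp_neg hψ hk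
  have := continuous_gpdOfExp ξ ψ
  exact integrable_of_isBigO_exp_neg hb (by fun_prop) h

lemma tendsto_gpdOfExp_pow_mul_exp_neg (hψ : 0 < ψ) (hk : k * ξ < 1) :
    Tendsto (fun u => gpdOfExp ξ ψ u ^ k * Real.exp (-u)) atTop (𝓝 0) := by
  obtain ⟨b, hb, h⟩ := exists_isBigO_gpdOfExp_pow_mul_exp_neg hψ hk
  refine h.trans_tendsto (Real.tendsto_exp_atBot.comp ?_)
  exact tendsto_id.const_mul_atTop_of_neg (neg_lt_zero.2 hb)

lemma integral_gpdOfExp_pow_succ_mul_exp_neg (hψ : 0 < ψ) (hk : (k + 1) * ξ < 1) :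
    ∫ u in Set.Ioi 0, gpdOfExp ξ ψ u ^ (k + 1) * Real.exp (-u) =
      (k + 1) * ψ / (1 - (k + 1) * ξ) * ∫ u in Set.Ioi 0, gpdOfExp ξ ψ u ^ k * Real.exp (-u) := by
  have hk1 : ((k + 1 : ℕ) : ℝ) * ξ < 1 := by exact_mod_cast hk
  have hk0 := natCast_mul_lt_one_of_le k.le_succ hk1
  have hi0 := integrableOn_gpdOfExp_pow_mul_exp_neg hψ hk0
  have hi1 := integrableOn_gpdOfExp_pow_mul_exp_neg hψ hk1
  have hderiv (u : ℝ) : HasDerivAt (fun u => gpdOfExp ξ ψ u ^ (k + 1) * Real.exp (-u))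
      ((k + 1) * ψ * (gpdOfExp ξ ψ u ^ k * Real.exp (-u)) -
        (1 - (k + 1) * ξ) * (gpdOfExp ξ ψ u ^ (k + 1) * Real.exp (-u))) u := by
    convert! ((hasDerivAt_gpdOfExp ξ ψ u).pow (k + 1)).mul (hasDerivAt_neg u).exp using 1
    simp only [Pi.pow_apply, Nat.add_sub_cancel, Nat.cast_add, Nat.cast_one]
    ring
  have hparts := integral_Ioi_of_hasDerivAt_of_tendsto' (a := 0) (fun u _ => hderiv u)
    ((hi0.const_mul _).sub (hi1.const_mul _)) (tendsto_gpdOfExp_pow_mul_exp_neg hψ hk1)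
  rw [integral_sub (hi0.const_mul _) (hi1.const_mul _), integral_const_mul, integral_const_mul,
    gpdOfExp_zero, zero_pow k.succ_ne_zero, zero_mul, sub_zero, sub_eq_zero] at hparts
  rw [div_mul_eq_mul_div, eq_div_iff (sub_pos.2 hk).ne', mul_comm]
  exact hparts.symm

/-- The `k`-th moment of `GPD(ξ, ψ)`, for `k ξ < 1`: each factor comes from one integration by
parts. -/
noncomputable def gpdMoment (ξ ψ : ℝ) (k : ℕ) : ℝ :=
  ∏ i ∈ Finset.range k, ((i + 1) * ψ / (1 - (i + 1) * ξ))

lemma gpdMoment_succ (ξ ψ : ℝ) (k : ℕ) :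
    gpdMoment ξ ψ (k + 1) = gpdMoment ξ ψ k * ((k + 1) * ψ / (1 - (k + 1) * ξ)) :=
  Finset.prod_range_succ _ _

lemma integral_gpdOfExp_pow_mul_exp_neg (hψ : 0 < ψ) (hk : k * ξ < 1) :
    ∫ u in Set.Ioi 0, gpdOfExp ξ ψ u ^ k * Real.exp (-u) = gpdMoment ξ ψ k := by
  induction k with
  | zero => simpa [gpdMoment] using integral_exp_neg_Ioi_zero
  | succ k ih =>
    have hk0 := natCast_mul_lt_one_of_le k.le_succ hk
    push_cast at hk
    rw [integral_gpdOfExp_pow_succ_mul_exp_neg hψ hk, ih hk0, gpdMoment_succ, mul_comm]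

lemma expMeasure_one_eq_withDensity : expMeasure 1 =
    (volume.restrict (Set.Ioi 0)).withDensity fun u => ENNReal.ofReal (Real.exp (-u)) := by
  have hpdf : exponentialPDF 1 =
      (Set.Ici 0).indicator fun u => ENNReal.ofReal (Real.exp (-u)) := by
    ext u
    rw [exponentialPDF_eq, Set.indicator_apply]
    by_cases hu : 0 ≤ u <;> simp [hu]
  calc expMeasure 1 = volume.withDensity (exponentialPDF 1) := rfl
    _ = (volume.restrict (Set.Ioi 0)).withDensity fun u => ENNReal.ofReal (Real.exp (-u)) := by
      rw [hpdf, withDensity_indicator measurableSet_Ici, restrict_Ioi_eq_restrict_Ici]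

lemma integrable_expMeasure_one_iff {f : ℝ → ℝ} :
    Integrable f (expMeasure 1) ↔ IntegrableOn (fun u => f u * Real.exp (-u)) (Set.Ioi 0) := by
  rw [expMeasure_one_eq_withDensity, integrable_withDensity_iff (by fun_prop)
    (ae_of_all _ fun u => ENNReal.ofReal_lt_top)]
  simp only [ENNReal.toReal_ofReal (Real.exp_pos _).le, IntegrableOn]

lemma integral_expMeasure_one (f : ℝ → ℝ) :
    ∫ u, f u ∂expMeasure 1 = ∫ u in Set.Ioi 0, f u * Real.exp (-u) := by
  rw [expMeasure_one_eq_withDensity, integral_withDensity_eq_integral_toReal_smul (by fun_prop)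
    (ae_of_all _ fun u => ENNReal.ofReal_lt_top)]
  simp only [ENNReal.toReal_ofReal (Real.exp_pos _).le, smul_eq_mul, mul_comm]

variable {η : Measure ℝ}

lemma IsGPD.integrable_pow (hη : IsGPD ξ ψ η) (hψ : 0 < ψ) (hk : k * ξ < 1) :
    Integrable (fun x => x ^ k) η := by
  have hmeas : Measurable (gpdOfExp ξ ψ) := (continuous_gpdOfExp ξ ψ).measurable
  rw [hη.eq_map_expMeasure hψ, integrable_map_measure (by fun_prop) hmeas.aemeasurable,
    integrable_expMeasure_one_iff]
  exact integrableOn_gpdOfExp_pow_mul_exp_neg hψ hk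

lemma IsGPD.integral_pow (hη : IsGPD ξ ψ η) (hψ : 0 < ψ) (hk : k * ξ < 1) :
    ∫ x, x ^ k ∂η = gpdMoment ξ ψ k := by
  have hmeas : Measurable (gpdOfExp ξ ψ) := (continuous_gpdOfExp ξ ψ).measurable
  rw [hη.eq_map_expMeasure hψ, integral_map hmeas.aemeasurable (by fun_prop),
    integral_expMeasure_one, integral_gpdOfExp_pow_mul_exp_neg hψ hk]

lemma gpdMoment_one (ξ ψ : ℝ) : gpdMoment ξ ψ 1 = ψ / (1 - ξ) := by
  simp [gpdMoment]

lemma gpdMoment_two (ξ ψ : ℝ) : gpdMoment ξ ψ 2 = 2 * ψ ^ 2 / ((1 - ξ) * (1 - 2 * ξ)) := by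
  rw [gpdMoment_succ, gpdMoment_one, div_mul_div_comm]
  push_cast
  ring

lemma gpdMoment_three (ξ ψ : ℝ) :
    gpdMoment ξ ψ 3 = 6 * ψ ^ 3 / ((1 - ξ) * (1 - 2 * ξ) * (1 - 3 * ξ)) := by
  rw [gpdMoment_succ, gpdMoment_two, div_mul_div_comm]
  push_cast
  ring

lemma gpdMoment_four (ξ ψ : ℝ) : gpdMoment ξ ψ 4 =
    24 * ψ ^ 4 / ((1 - ξ) * (1 - 2 * ξ) * (1 - 3 * ξ) * (1 - 4 * ξ)) := by
  rw [gpdMoment_succ, gpdMoment_three, div_mul_div_comm]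
  push_cast
  ring

lemma IsGPD.memLp_id (hη : IsGPD ξ ψ η) (hψ : 0 < ψ) (hk0 : k ≠ 0) (hk : k * ξ < 1) :
    MemLp id k η := by
  have := hη.1
  refine (integrable_norm_rpow_iff (by fun_prop) (by exact_mod_cast hk0) (by finiteness)).1 ?_
  simpa only [norm_pow, id_eq, ENNReal.toReal_natCast, Real.rpow_natCast] using
    (hη.integrable_pow hψ hk).norm

lemma IsGPD.integral_id (hη : IsGPD ξ ψ η) (hψ : 0 < ψ) (hξ : ξ < 1) :
    ∫ x, x ∂η = ψ / (1 - ξ) := by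
  simpa [gpdMoment_one] using hη.integral_pow (k := 1) hψ (by simpa using hξ)

lemma IsGPD.variance_id (hη : IsGPD ξ ψ η) (hψ : 0 < ψ) (hξ : ξ < 1 / 2) :
    Var[id; η] = ψ ^ 2 / ((1 - ξ) ^ 2 * (1 - 2 * ξ)) := by
  have := hη.1
  have h1 : 1 - ξ ≠ 0 := by linarith
  have h2 : 1 - 2 * ξ ≠ 0 := by linarith
  have h2ξ : ((2 : ℕ) : ℝ) * ξ < 1 := by
    push_cast
    linarith
  have hsq : ∫ x, (id ^ 2 : ℝ → ℝ) x ∂η = _ := hη.integral_pow hψ h2ξ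
  have hmean : ∫ x, id x ∂η = _ := hη.integral_id hψ (by linarith)
  rw [variance_eq_sub (hη.memLp_id hψ two_ne_zero h2ξ), hsq, hmean, gpdMoment_two]
  field_simp
  ring

lemma IsGPD.coeffVar_eq (hη : IsGPD ξ ψ η) (hψ : 0 < ψ) (hξ : ξ < 1 / 2) :
    coeffVar η = gpdCV ξ := by
  have h1 : 0 < 1 - ξ := by linarith
  rw [coeffVar, hη.variance_id hψ hξ, hη.integral_id hψ (by linarith), gpdCV,
    ← div_div, ← div_pow, div_eq_mul_one_div (_ ^ 2),
    Real.sqrt_mul (by positivity), Real.sqrt_sq (by positivity),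
    mul_div_cancel_left₀ _ (by positivity)]

lemma IsGPD.variance_cvInfluence (hη : IsGPD ξ ψ η) (hψ : 0 < ψ) (hξ : ξ < 1 / 4) :
    Var[cvInfluence η; η] = gpdAsympVar ξ := by
  have := hη.1
  have h4ξ : ((4 : ℕ) : ℝ) * ξ < 1 := by
    push_cast
    linarith
  have h1 : 1 - ξ ≠ 0 := by linarith
  have h2 : 1 - ξ * 2 ≠ 0 := by linarith
  have h3 : 1 - ξ * 3 ≠ 0 := by linarith
  have h4 : 1 - ξ * 4 ≠ 0 := by linarith
  rw [_root_.variance_cvInfluence (by exact_mod_cast hη.memLp_id hψ four_ne_zero h4ξ)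
    fun k hk4 => hη.integral_pow hψ (natCast_mul_lt_one_of_le hk4 h4ξ),
    hη.variance_id hψ (by linarith), gpdMoment_one, gpdMoment_two, gpdMoment_three,
    gpdMoment_four, gpdAsympVar]
  field_simp
  ring

lemma gpdAsympVar_zero : gpdAsympVar 0 = 1 := by norm_num [gpdAsympVar]

lemma gpdAsympVar_neg_one : gpdAsympVar (-1) = 8 / 45 := by norm_num [gpdAsympVar]

end Moments

theorem corollary4_general {Ω Ω' : Type*} [MeasurableSpace Ω] [MeasurableSpace Ω'] {P : Measure Ω}
    {P' : Measure Ω'} [IsProbabilityMeasure P] [IsProbabilityMeasure P'] {ξ ψ t : ℝ}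
    (hξ : ξ < 1 / 4) (hψ : 0 < ψ) (ht : 0 ≤ t) (htop : 0 < ψ + ξ * t) {X : ℕ → Ω → ℝ}
    (hmeas : ∀ j, AEMeasurable (X j) P) (hindep : iIndepFun X P)
    (hlaw : ∀ j, IsGPD ξ ψ (P.map (X j))) (d : ℕ) {Y : Ω' → ℝ}
    (hY : HasLaw Y (gaussianReal 0 (gpdAsympVar ξ).toNNReal) P') :
    TendstoInDistribution
      (fun (n : ℕ) ω => √(numExceedances (fun j => X j ω) n t : ℝ) *
        (residualCV d (fun j => X j ω) n t - gpdCV ξ))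
      atTop Y (fun _ => P) P' := by
  have hX (j : ℕ) : HasLaw (X j) ((expMeasure 1).map (gpdOfExp ξ ψ)) P :=
    ⟨hmeas j, (hlaw j).eq_map_expMeasure hψ⟩
  have hν : IsGPD ξ ψ ((expMeasure 1).map (gpdOfExp ξ ψ)) := (hX 0).map_eq ▸ hlaw 0
  have := hν.1
  have hη := hν.excessLaw hψ ht htop
  have hvar : Var[id; excessLaw ((expMeasure 1).map (gpdOfExp ξ ψ)) t] ≠ 0 := by
    rw [hη.variance_id htop (by linarith)]
    have h1 : 0 < 1 - ξ := by linarith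
    have h2 : 0 < 1 - 2 * ξ := by linarith
    positivity
  rw [← hη.coeffVar_eq htop (by linarith)]
  rw [← hη.variance_cvInfluence htop hξ] at hY
  exact tendstoInDistribution_residualCV hX hindep (hν.measure_Ioi_ne_zero hψ ht htop)
    (by exact_mod_cast hη.memLp_id htop four_ne_zero (by push_cast; linarith)) hvar d hY

theorem corollary4 {Ω : Type*} [MeasurableSpace Ω] (P : Measure Ω) [IsProbabilityMeasure P]
    (ξ ψ t : ℝ) (hξ : ξ < 1 / 4) (hψ : 0 < ψ) (ht : 0 ≤ t)
    (htop : 0 < ψ + ξ * t)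
    (X : ℕ → Ω → ℝ) (hmeas : ∀ j, AEMeasurable (X j) P) (hindep : iIndepFun X P)
    (hlaw : ∀ j, IsGPD ξ ψ (P.map (X j)))
    (d : ℕ) (hd : d = 0 ∨ d = 1) :
    TendstoInDistribution
      (fun (n : ℕ) (ω : Ω) =>
        √(numExceedances (fun j => X j ω) n t : ℝ) *
          (residualCV d (fun j => X j ω) n t - gpdCV ξ))
      atTop (id : ℝ → ℝ) (fun _ => P) (gaussianReal 0 (gpdAsympVar ξ).toNNReal) ∧
    gpdAsympVar 0 = 1 ∧ gpdAsympVar (-1) = 8 / 45 :=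
  ⟨corollary4_general hξ hψ ht htop hmeas hindep hlaw d .id, gpdAsympVar_zero, gpdAsympVar_neg_one⟩
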